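/- **Theorem (Uniqueness in the Strichartz class).** Let $\Omega\subset\mathbb R^3$ be a bounded open set, let $a\in W^{1,\infty}(\Omega)$ satisfy $a\ge 0$ a.e. in $\Omega$, let $T>0$, and let $(u_0,u_1)\in H_0^1(\Omega)\times L^2(\Omega)$ (real-valued). Consider the critical wave equation with Kelvin–Voigt damping $$ \begin{cases} u_{tt}-\Delta u-\operatorname{div}\big(a(x)\nabla u_t\big)+u^5=0 & \text{in }\Omega\times(0,T),\\ u=0 & \text{on }\partial\Omega\times(0,T),\\ u(0)=u_0,\quad u_t(0)=u_1 & \text{in }\Omega . \end{cases} $$ An energy-class solution is a function $u\in C([0,T];H_0^1(\Omega))\cap C^1([0,T];L^2(\Omega))$ with $u(0)=u_0$, $u_t(0)=u_1$ that satisfies the equation in the sense of distributions on $(0,T)\times\Omega$, that is, for every $\varphi\in C_c^\infty((0,T)\times\Omega)$, $$ \int_0^T\Big(-\int_\Omega u_t\,\varphi_t\,dx+\int_\Omega\nabla u\cdot\nabla\varphi\,dx-\int_\Omega a\,\nabla u\cdot\nabla\varphi_t\,dx+\int_\Omega u^5\varphi\,dx\Big)dt=0 . $$ Let $u$ and $v$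 be two energy-class solutions with the same initial data $(u_0,u_1)$. If, in addition, $u,v\in L^4(0,T;L^{12}(\Omega))$, then $u(t)=v(t)$ for all $t\in[0,T]$. -/

import Mathlib

open MeasureTheory Set
open scoped ContDiff ENNReal

noncomputable section

/-- Three-dimensional Euclidean space. -/
abbrev E3 : Type := EuclideanSpace ℝ (Fin 3)

/-- `L²(Ω)`, real-valued. -/
abbrev L2 (Ω : Set E3) : Type := Lp ℝ 2 (volume.restrict Ω)

/-- `L²(Ω; ℝ³)`. -/
abbrev L2Vec (Ω : Set E3) : Type := Lp E3 2 (volume.restrict Ω)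

/-- `φ ∈ C_c^∞(Ω)`. -/
structure IsTestFunction (Ω : Set E3) (φ : E3 → ℝ) : Prop where
  smooth : ContDiff ℝ ∞ φ
  compact : HasCompactSupport φ
  support : tsupport φ ⊆ Ω

/-- `φ ∈ C_c^∞((0,T) × Ω)`. -/
structure IsSpaceTimeTest (T : ℝ) (Ω : Set E3) (φ : ℝ × E3 → ℝ) : Prop where
  smooth : ContDiff ℝ ∞ φ
  compact : HasCompactSupport φ
  support : tsupport φ ⊆ Ioo 0 T ×ˢ Ω

/-- `g` is the weak (distributional) gradient of `f` in `Ω`. -/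
def HasWeakGradient (Ω : Set E3) (f : E3 → ℝ) (g : E3 → E3) : Prop :=
  ∀ φ : E3 → ℝ, IsTestFunction Ω φ →
    ∫ x in Ω, f x • gradient φ x = -∫ x in Ω, φ x • g x

/-- `f ∈ W^{1,∞}(Ω)`. -/
def MemW1Infty (Ω : Set E3) (f : E3 → ℝ) : Prop :=
  MemLp f ⊤ (volume.restrict Ω) ∧
    ∃ g : E3 → E3, MemLp g ⊤ (volume.restrict Ω) ∧ HasWeakGradient Ω f g

/-- The pairs `(φ, ∇φ)` with `φ ∈ C_c^∞(Ω)`, in `L²(Ω) × L²(Ω; ℝ³)` with the Hilbert norm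
`(‖f‖² + ‖g‖²)^{1/2}`, which is the `H¹` norm of `φ`. -/
def testGraph (Ω : Set E3) : Submodule ℝ (WithLp 2 (L2 Ω × L2Vec Ω)) where
  carrier := {p | ∃ φ : E3 → ℝ, IsTestFunction Ω φ ∧
    p.fst =ᵐ[volume.restrict Ω] φ ∧ p.snd =ᵐ[volume.restrict Ω] gradient φ}
  zero_mem' := by
    refine ⟨0, ⟨contDiff_const, HasCompactSupport.zero, by simp⟩, Lp.coeFn_zero _ _ _, ?_⟩
    refine (Lp.coeFn_zero _ _ _).trans (Filter.Eventually.of_forall fun x => ?_)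
    exact (gradient_fun_const x 0).symm
  add_mem' := by
    rintro p q ⟨φ, hφ, hp, hp'⟩ ⟨ψ, hψ, hq, hq'⟩
    refine ⟨φ + ψ, ⟨hφ.smooth.add hψ.smooth, hφ.compact.add hψ.compact,
      (tsupport_add φ ψ).trans (union_subset hφ.support hψ.support)⟩, ?_, ?_⟩
    · exact (Lp.coeFn_add _ _).trans (hp.add hq)
    · refine ((Lp.coeFn_add _ _).trans (hp'.add hq')).trans
        (Filter.Eventually.of_forall fun x => ?_)
      have h1 : DifferentiableAt ℝ φ x := (hφ.smooth.differentiable (by simp)) x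
      have h2 : DifferentiableAt ℝ ψ x := (hψ.smooth.differentiable (by simp)) x
      simp [gradient, fderiv_add h1 h2]
  smul_mem' := by
    rintro c p ⟨φ, hφ, hp, hp'⟩
    refine ⟨c • φ, ⟨hφ.smooth.const_smul c, hφ.compact.smul_left,
      (tsupport_smul_subset_right (fun _ => c) φ).trans hφ.support⟩, ?_, ?_⟩
    · exact (Lp.coeFn_smul _ _).trans (hp.const_smul c)
    · refine ((Lp.coeFn_smul _ _).trans (hp'.const_smul c)).trans
        (Filter.Eventually.of_forall fun x => ?_)
      have h1 : DifferentiableAt ℝ φ x := (hφ.smooth.differentiable (by simp)) x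
      simp [gradient, fderiv_const_smul h1]

/-- `H_0^1(Ω)`: the closure of `C_c^∞(Ω)` in the `H¹` norm. An element is stored as the pair of
a function and its weak gradient. -/
abbrev H10 (Ω : Set E3) : Type := (testGraph Ω).topologicalClosure

/-- The function underlying an element of `H_0^1(Ω)`. -/
def H10.fn {Ω : Set E3} (u : H10 Ω) : L2 Ω := u.1.fst

/-- The gradient of an element of `H_0^1(Ω)`. -/
def H10.grad {Ω : Set E3} (u : H10 Ω) : L2Vec Ω := u.1.snd

/-- `u_t(t) ∈ L²(Ω)`, the (one-sided at `0` and `T`) time derivative of `u : [0,T] → L²(Ω)`. -/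
def timeDeriv {Ω : Set E3} (T : ℝ) (u : ℝ → H10 Ω) (t : ℝ) : L2 Ω :=
  derivWithin (fun s => (u s).fn) (Icc 0 T) t

/-- `u ∈ C([0,T]; H_0^1(Ω)) ∩ C¹([0,T]; L²(Ω))`. Values of `u` outside `[0,T]` play no role. -/
def InEnergySpace {Ω : Set E3} (T : ℝ) (u : ℝ → H10 Ω) : Prop :=
  ContinuousOn u (Icc 0 T) ∧ ContDiffOn ℝ 1 (fun s => (u s).fn) (Icc 0 T)

/-- The equation `u_tt - Δu - div(a ∇u_t) + u⁵ = 0` in the sense of distributions on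
`(0,T) × Ω`. As `a` does not depend on time, `a ∇u_t` is the distribution `∂_t (a ∇u)`. -/
def SolvesWeakly {Ω : Set E3} (a : E3 → ℝ) (T : ℝ) (u : ℝ → H10 Ω) : Prop :=
  ∀ φ : ℝ × E3 → ℝ, IsSpaceTimeTest T Ω φ →
    ∫ t in Ioo 0 T,
      (-(∫ x in Ω, timeDeriv T u t x * deriv (fun s => φ (s, x)) t)
        + (∫ x in Ω, inner ℝ ((u t).grad x) (gradient (fun y => φ (t, y)) x))
        - (∫ x in Ω, a x * inner ℝ ((u t).grad x)
            (gradient (fun y => deriv (fun s => φ (s, y)) t) x))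
        + (∫ x in Ω, ((u t).fn x) ^ 5 * φ (t, x))) = 0

/-- `u` is an energy-class solution on `[0,T]` of the critical problem
`u_tt - Δu - div(a ∇u_t) + u⁵ = 0` in `Ω × (0,T)`, `u = 0` on `∂Ω × (0,T)`,
`u(0) = u₀`, `u_t(0) = u₁`. The boundary condition is `u(t) ∈ H_0^1(Ω)`. -/
structure IsEnergySolution {Ω : Set E3} (a : E3 → ℝ) (T : ℝ) (u₀ : H10 Ω) (u₁ : L2 Ω)
    (u : ℝ → H10 Ω) : Prop where
  energy_space : InEnergySpace T u
  equation : SolvesWeakly a T u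
  init : u 0 = u₀
  init_deriv : timeDeriv T u 0 = u₁

instance fact_one_le_twelve : Fact ((1 : ℝ≥0∞) ≤ 12) := ⟨by norm_num⟩

/-- `u ∈ L⁴(0,T; L¹²(Ω))` (Bochner space). -/
def InStrichartzClass {Ω : Set E3} (T : ℝ) (u : ℝ → H10 Ω) : Prop :=
  ∃ U : ℝ → Lp ℝ 12 (volume.restrict Ω),
    MemLp U 4 (volume.restrict (Ioo 0 T)) ∧
      ∀ᵐ t ∂(volume.restrict (Ioo 0 T)), U t =ᵐ[volume.restrict Ω] (u t).fn

end

/-! ### Distributional identities in time. -/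

noncomputable section

open Filter Topology

/-! Let w = u - v. Testing the equation for w with w_t is not allowed: w_t is only in L²(Ω), and
since a may vanish the damping yields no control of ∇w_t. Instead the equation is integrated over
[s, s+h] and tested with w(s+h) - w(s), which does lie in H_0^1. The damping term becomes ∫
a|∇(w(s+h) - w(s))|² ≥ 0 and is dropped. The same increment is the s-derivative of ∫_s^{s+h} w, so
the inertial and elastic terms are half the derivative of h² times the energy of the Steklov average
of w. Dividing by h² and letting h → 0 gives an energy inequality that uses only the L² norm of w_t
against the forcing (`DampedEquation.steklov_energy_le`, `DampedEquation.energy_le`).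

Hölder with 4/12 + 1/6 + 1/2 = 1 and the Sobolev embedding give |∫ (u⁵ - v⁵) q| ≤ m(t) ‖∇w‖ ‖q‖ in
L² norms, where m is a multiple of ‖u‖⁴ + ‖v‖⁴ in L¹² and so is integrable in time
(`abs_quintic_sub_le_of_ae_eq`). On an interval where m has mass at most 1/4, the maximal energy is
at most half of itself, hence zero; a continuation argument then covers [0,T]
(`DampedEquation.eq_zero`).

The integrated equation comes from product tests θ(t)φ(x), the du Bois-Reymond lemma in time, and
density of C_c^∞(Ω) in H_0^1(Ω) (`SolvesWeakly.integrated`). There a∇u_t appears only as the time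
derivative of a∇u. -/

/-- `θ ∈ C_c^∞(0,T)`. -/
structure IsTimeTest (T : ℝ) (θ : ℝ → ℝ) : Prop where
  smooth : ContDiff ℝ ∞ θ
  compact : HasCompactSupport θ
  support : tsupport θ ⊆ Ioo 0 T

/-- A test function of mean zero on an interval is the derivative of a test function. -/
theorem IsTimeTest.exists_primitive {T : ℝ} {ξ : ℝ → ℝ} (hξ : IsTimeTest T ξ)
    (hmean : ∫ t, ξ t = 0) : ∃ θ : ℝ → ℝ, IsTimeTest T θ ∧ deriv θ = ξ := by
  rcases (tsupport ξ).eq_empty_or_nonempty with he | hne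
  · have h0 : ξ = 0 := tsupport_eq_empty_iff.1 he
    refine ⟨0, ⟨contDiff_const, HasCompactSupport.zero, by simp⟩, ?_⟩
    rw [h0]
    ext t
    simp
  have hc : IsCompact (tsupport ξ) := hξ.compact
  obtain ⟨α, hα, hα'⟩ := hc.exists_isLeast hne
  obtain ⟨β, hβ, hβ'⟩ := hc.exists_isGreatest hne
  have h0α : 0 < α := (hξ.support hα).1
  have hβT : β < T := (hξ.support hβ).2
  have hzero : ∀ t, t ∉ Icc α β → ξ t = 0 := fun t ht =>
    image_eq_zero_of_notMem_tsupport fun h => ht ⟨hα' h, hβ' h⟩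
  have hder : ∀ t, HasDerivAt (fun t => ∫ s in (0 : ℝ)..t, ξ s) (ξ t) t := fun t =>
    (hξ.smooth.continuous.integral_hasStrictDerivAt 0 t).hasDerivAt
  have hderiv : deriv (fun t => ∫ s in (0 : ℝ)..t, ξ s) = ξ := funext fun t => (hder t).deriv
  -- The base point 0 lies left of the support, so the primitive vanishes before α; after β it has
  -- collected the whole integral, which is zero.
  have hsupp : Function.support (fun t => ∫ s in (0 : ℝ)..t, ξ s) ⊆ Icc α β := by
    intro t ht
    by_contra hn
    apply ht
    rcases lt_or_ge t α with h | h
    · refine (intervalIntegral.integral_congr (g := fun _ => 0) fun s hs =>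
        hzero s fun hs' => ?_).trans (by simp)
      have := hs.2
      have : s < α := lt_of_le_of_lt this (max_lt h0α h)
      exact absurd hs'.1 (not_le.2 this)
    · have hb : β < t := by
        by_contra hb
        exact hn ⟨h, not_lt.1 hb⟩
      refine Eq.trans ?_ hmean
      refine intervalIntegral.integral_eq_integral_of_support_subset fun s hs => ?_
      by_contra hs'
      refine hs (hzero s fun h => hs' ⟨h0α.trans_le h.1, h.2.trans hb.le⟩)
  have hts : tsupport (fun t => ∫ s in (0 : ℝ)..t, ξ s) ⊆ Icc α β :=
    closure_minimal hsupp isClosed_Icc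
  refine ⟨_, ⟨?_, HasCompactSupport.of_support_subset_isCompact isCompact_Icc hsupp,
    hts.trans fun t ht => ⟨h0α.trans_le ht.1, ht.2.trans_lt hβT⟩⟩, hderiv⟩
  rw [contDiff_infty_iff_deriv, hderiv]
  exact ⟨fun t => (hder t).differentiableAt, hξ.smooth⟩

/-- The du Bois-Reymond lemma. -/
theorem exists_const_of_integral_deriv_mul_eq_zero {T : ℝ} (hT : 0 < T) {K : ℝ → ℝ}
    (hK : Continuous K) (h : ∀ θ, IsTimeTest T θ → ∫ t, deriv θ t * K t = 0) :
    ∃ c, ∀ t ∈ Icc 0 T, K t = c := by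
  -- The outer radius T/4 keeps the closed support inside (0,T). The normalised bump fixes the
  -- constant c as a weighted mean of K.
  let b : ContDiffBump (T / 2) := ⟨T / 8, T / 4, by positivity, by linarith⟩
  let ρ : ℝ → ℝ := b.normed volume
  have hρ : IsTimeTest T ρ := by
    refine ⟨b.contDiff_normed, b.hasCompactSupport_normed, ?_⟩
    rw [b.tsupport_normed_eq, Real.closedBall_eq_Icc]
    intro t ht
    have h1 := ht.1
    have h2 := ht.2
    simp only [b] at h1 h2
    constructor <;> linarith
  have hρ1 : ∫ t, ρ t = 1 := b.integral_normed
  refine ⟨∫ t, ρ t * K t, ?_⟩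
  set c := ∫ t, ρ t * K t with hc
  have hint : ∀ θ, IsTimeTest T θ → ∀ L : ℝ → ℝ, Continuous L →
      Integrable fun t => θ t * L t := fun θ hθ L hL =>
    (hθ.smooth.continuous.mul hL).integrable_of_hasCompactSupport hθ.compact.mul_right
  have hae : ∀ᵐ t, t ∈ Ioo 0 T → K t - c = 0 := by
    refine isOpen_Ioo.ae_eq_zero_of_integral_contDiff_smul_eq_zero
      ((hK.sub continuous_const).locallyIntegrable.locallyIntegrableOn _) fun η h1 h2 h3 => ?_
    have hη : IsTimeTest T η := ⟨h1, h2, h3⟩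
    set m := ∫ t, η t with hm
    have hηi : Integrable η := h1.continuous.integrable_of_hasCompactSupport h2
    have hρi : Integrable ρ := hρ.smooth.continuous.integrable_of_hasCompactSupport hρ.compact
    -- Subtracting m ρ makes the mean zero, so an arbitrary η becomes an admissible derivative up to
    -- a multiple of ρ.
    have hξ : IsTimeTest T (fun t => η t - m * ρ t) := by
      refine ⟨h1.sub (contDiff_const.mul hρ.smooth), h2.sub hρ.compact.mul_left, ?_⟩
      refine (tsupport_sub η (fun t => m * ρ t)).trans (union_subset h3 ?_)
      exact (tsupport_mul_subset_right (f := fun _ => m)).trans hρ.support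
    obtain ⟨θ, hθ, hθ'⟩ := hξ.exists_primitive (by
      rw [integral_sub hηi (hρi.const_mul m), integral_const_mul, hρ1, ← hm]; ring)
    have := h θ hθ
    rw [hθ'] at this
    have e1 : ∫ t, (η t - m * ρ t) * K t = (∫ t, η t * K t) - m * c := by
      rw [hc, ← integral_const_mul, ← integral_sub (hint η hη K hK) ((hint ρ hρ K hK).const_mul m)]
      congr 1
      ext t
      ring
    have e2 : ∫ t, η t • (K t - c) = (∫ t, η t * K t) - m * c := by
      rw [hm, ← integral_mul_const, ← integral_sub (hint η hη K hK) (hηi.mul_const c)]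
      congr 1
      ext t
      simp only [smul_eq_mul]
      ring
    rw [e2, ← e1, this]
  have hIcc : K =ᵐ[volume.restrict (Icc 0 T)] fun _ => c := by
    have : K =ᵐ[volume.restrict (Ioo 0 T)] fun _ => c := by
      rw [EventuallyEq, ae_restrict_iff' measurableSet_Ioo]
      filter_upwards [hae] with t ht htm
      linarith [ht htm]
    rwa [Measure.restrict_congr_set Ioo_ae_eq_Icc] at this
  exact fun t ht => Measure.eqOn_Icc_of_ae_eq volume hT.ne hIcc hK.continuousOn
    continuousOn_const ht

/-- If `g' = -H` in the sense of distributions with `g`, `H` continuous, then the fundamental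
theorem of calculus holds. -/
theorem sub_eq_neg_integral_of_weak_deriv {T : ℝ} (hT : 0 < T) {g H : ℝ → ℝ}
    (hg : ContinuousOn g (Icc 0 T)) (hH : ContinuousOn H (Icc 0 T))
    (h : ∀ θ, IsTimeTest T θ → ∫ t in Ioo 0 T, (-(deriv θ t * g t) + θ t * H t) = 0)
    {s t : ℝ} (hs : s ∈ Icc 0 T) (ht : t ∈ Icc 0 T) :
    g t - g s + ∫ r in s..t, H r = 0 := by
  set g' : ℝ → ℝ := IccExtend hT.le ((Icc 0 T).domRestrict g) with hg'
  set H' : ℝ → ℝ := IccExtend hT.le ((Icc 0 T).domRestrict H) with hH'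
  have cg : Continuous g' := hg.domRestrict.Icc_extend'
  have cH : Continuous H' := hH.domRestrict.Icc_extend'
  have eg : ∀ t ∈ Icc 0 T, g' t = g t := fun t ht => by
    rw [hg', IccExtend_of_mem _ _ ht, domRestrict_apply]
  have eH : ∀ t ∈ Icc 0 T, H' t = H t := fun t ht => by
    rw [hH', IccExtend_of_mem _ _ ht, domRestrict_apply]
  have hder : ∀ t, HasDerivAt (fun t => ∫ s in (0 : ℝ)..t, H' s) (H' t) t := fun t =>
    (cH.integral_hasStrictDerivAt 0 t).hasDerivAt
  have cI : Continuous fun t => ∫ s in (0 : ℝ)..t, H' s :=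
    continuous_iff_continuousAt.2 fun t => (hder t).continuousAt
  -- It is g plus the primitive of H that should be constant.
  obtain ⟨c, hc⟩ := exists_const_of_integral_deriv_mul_eq_zero hT (cg.add cI) fun θ hθ => by
    have hθc : Continuous (deriv θ) := hθ.smooth.continuous_deriv (by simp)
    have hz : ∀ t, t ∉ Ioo 0 T → θ t = 0 := fun t ht =>
      image_eq_zero_of_notMem_tsupport fun h' => ht (hθ.support h')
    have hdz : Function.support (deriv θ) ⊆ Ioc 0 T :=
      (support_deriv_subset.trans hθ.support).trans Ioo_subset_Ioc_self
    have hθd : ∀ t, HasDerivAt θ (deriv θ t) t := fun t =>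
      (hθ.smooth.differentiable (by simp) t).hasDerivAt
    rw [← intervalIntegral.integral_eq_integral_of_support_subset (a := 0) (b := T)
      ((Function.support_mul_subset_left _ _).trans hdz)]
    have h1 : ∫ t in (0 : ℝ)..T, (-(deriv θ t * g' t) + θ t * H' t) = 0 := by
      rw [intervalIntegral.integral_of_le hT.le, integral_Ioc_eq_integral_Ioo]
      refine Eq.trans ?_ (h θ hθ)
      refine setIntegral_congr_fun measurableSet_Ioo fun t ht => ?_
      simp only [eg t (Ioo_subset_Icc_self ht), eH t (Ioo_subset_Icc_self ht)]
    -- Integration by parts moves the derivative onto the primitive; the boundary terms vanish with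
    -- θ at 0 and T.
    have h2 := intervalIntegral.integral_deriv_mul_eq_sub (a := 0) (b := T)
      (fun x _ => hθd x) (fun x _ => hder x) (hθc.intervalIntegrable _ _)
      (cH.intervalIntegrable _ _)
    rw [hz 0 (by simp), hz T (by simp), zero_mul, zero_mul, sub_zero] at h2
    have h3 : ∫ t in (0 : ℝ)..T, deriv θ t * (g' t + ∫ s in (0 : ℝ)..t, H' s) =
        (∫ t in (0 : ℝ)..T, (deriv θ t * (∫ s in (0 : ℝ)..t, H' s) + θ t * H' t)) -
        ∫ t in (0 : ℝ)..T, (-(deriv θ t * g' t) + θ t * H' t) := by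
      rw [← intervalIntegral.integral_sub]
      · congr 1
        ext t
        ring
      · exact ((hθc.mul cI).add (hθ.smooth.continuous.mul cH)).intervalIntegrable _ _
      · exact ((hθc.mul cg).neg.add (hθ.smooth.continuous.mul cH)).intervalIntegrable _ _
    exact h3.trans (by rw [h1, h2, sub_zero])
  have e1 := hc s hs
  have e2 := hc t ht
  have e3 : ∫ r in s..t, H r = ∫ r in s..t, H' r :=
    intervalIntegral.integral_congr fun r hr => (eH r (uIcc_subset_Icc hs ht hr)).symm
  have e4 := intervalIntegral.integral_add_adjacent_intervals
    (cH.intervalIntegrable (μ := volume) 0 s) (cH.intervalIntegrable s t)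
  simp only [Pi.add_apply] at e1 e2
  rw [eg s hs] at e1
  rw [eg t ht] at e2
  rw [e3]
  linarith

/-! ### The abstract energy inequality by Steklov averages. -/

theorem HasDerivWithinAt.tendsto_slope_zero_of_Icc {X : Type*} [NormedAddCommGroup X]
    [NormedSpace ℝ X] {f : ℝ → X} {f' : X} {t₀ t₁ t : ℝ} (ht : t ∈ Ico t₀ t₁)
    (hf : HasDerivWithinAt f f' (Icc t₀ t₁) t) :
    Tendsto (fun h => h⁻¹ • (f (t + h) - f t)) (𝓝[>] 0) (𝓝 f') := by
  have h1 : HasDerivWithinAt f f' (Ioi t) t :=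
    hf.mono_of_mem_nhdsWithin (Icc_mem_nhdsGT_of_mem ht)
  rw [hasDerivWithinAt_iff_tendsto_slope' self_notMem_Ioi] at h1
  have h2 : Tendsto (fun h => t + h) (𝓝[>] 0) (𝓝[>] t) := by
    refine tendsto_nhdsWithin_iff.2 ⟨?_, ?_⟩
    · have : Tendsto (fun h => t + h) (𝓝 0) (𝓝 (t + 0)) :=
        (continuous_const.add continuous_id).tendsto 0
      rw [add_zero] at this
      exact this.mono_left nhdsWithin_le_nhds
    · filter_upwards [self_mem_nhdsWithin] with h hh
      exact lt_add_of_pos_right t hh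
  refine (h1.comp h2).congr fun h => ?_
  simp [slope]

section Energy

variable {V X Y : Type*} [NormedAddCommGroup V] [NormedSpace ℝ V]
  [NormedAddCommGroup X] [InnerProductSpace ℝ X] [NormedAddCommGroup Y] [InnerProductSpace ℝ Y]

/-- The integrated equation `z' + B w' + d* d w + ℓ = 0`, `z = (j w)'`, on `[t₀, t₁]`, where
`B ≥ 0` is the damping form and the forcing `ℓ` is controlled by `f ∈ L¹`. -/
structure DampedEquation (j : V →L[ℝ] X) (d : V →L[ℝ] Y) (B : V → V → ℝ) (w : ℝ → V)
    (z : ℝ → X) (ℓ : ℝ → V → ℝ) (f : ℝ → ℝ) (t₀ t₁ : ℝ) : Prop where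
  continuous : Continuous w
  deriv : ∀ t ∈ Icc t₀ t₁, HasDerivWithinAt (fun s => j (w s)) (z t) (Icc t₀ t₁) t
  nonneg : ∀ x, 0 ≤ B x x
  integrable : ∀ a b, IntervalIntegrable f volume a b
  forcing_nonneg : ∀ r, 0 ≤ f r
  forcing_le : ∀ᵐ r, r ∈ Icc t₀ t₁ → ∀ ψ, |ℓ r ψ| ≤ f r * ‖j ψ‖
  forcing_integrable : ∀ ψ, ∀ s ∈ Icc t₀ t₁, ∀ t ∈ Icc t₀ t₁,
    IntervalIntegrable (fun r => ℓ r ψ) volume s t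
  equation : ∀ s ∈ Icc t₀ t₁, ∀ t ∈ Icc t₀ t₁, ∀ ψ,
    inner ℝ (z t - z s) (j ψ) + B (w t - w s) ψ
      + ∫ r in s..t, (inner ℝ (d (w r)) (d ψ) + ℓ r ψ) = 0

variable {j : V →L[ℝ] X} {d : V →L[ℝ] Y} {B : V → V → ℝ} {w : ℝ → V}
    {z : ℝ → X} {ℓ : ℝ → V → ℝ} {f : ℝ → ℝ} {t₀ t₁ : ℝ}

/-- The energy inequality for Steklov averages. -/
theorem DampedEquation.steklov_energy_le [CompleteSpace V]
    (H : DampedEquation j d B w z ℓ f t₀ t₁)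
    {Z : ℝ} (hZ : ∀ t ∈ Icc t₀ t₁, ‖z t‖ ≤ Z) {h : ℝ} (hh : 0 < h) {t : ℝ} (ht₀ : t₀ ≤ t)
    (ht₁ : t + h ≤ t₁) :
    ‖j (w (t + h) - w t)‖ ^ 2 + ‖d (∫ r in t..t + h, w r)‖ ^ 2 ≤
      ‖j (w (t₀ + h) - w t₀)‖ ^ 2 + ‖d (∫ r in t₀..t₀ + h, w r)‖ ^ 2
        + 2 * Z * h ^ 2 * ∫ r in t₀..t₁, f r := by
  have hw := H.continuous
  have hZ0 : 0 ≤ Z := (norm_nonneg _).trans (hZ t₀ ⟨le_rfl, by linarith⟩)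
  have hfi := H.integrable
  set P : ℝ → ℝ := fun s => ∫ r in t₀..s, f r with hP
  have hPc : Continuous P := intervalIntegral.continuous_primitive hfi t₀
  have hPsub : ∀ a b, P b - P a = ∫ r in a..b, f r := fun a b =>
    intervalIntegral.integral_interval_sub_left (hfi _ _) (hfi _ _)
  have hPmono : Monotone P := fun a b hab => by
    have := intervalIntegral.integral_nonneg (μ := volume) hab fun r _ => H.forcing_nonneg r
    linarith [hPsub a b]
  set W : ℝ → V := fun s => ∫ r in t₀..s, w r with hW
  have hWd : ∀ s, HasDerivAt W (w s) s := fun s =>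
    (hw.integral_hasStrictDerivAt t₀ s).hasDerivAt
  have hWsub : ∀ a b, W b - W a = ∫ r in a..b, w r := fun a b =>
    intervalIntegral.integral_interval_sub_left (hw.intervalIntegrable _ _)
      (hw.intervalIntegrable _ _)
  -- As f is only integrable, P need not be differentiable. The forcing bound involves increments of
  -- P, and its antiderivative R is C¹, so G below is differentiable at every interior point.
  set R : ℝ → ℝ := fun s => ∫ r in t₀..s, P r with hR
  have hRd : ∀ s, HasDerivAt R (P s) s := fun s =>
    (hPc.integral_hasStrictDerivAt t₀ s).hasDerivAt
  have hRsub : ∀ a b, R b - R a = ∫ r in a..b, P r := fun a b =>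
    intervalIntegral.integral_interval_sub_left (hPc.intervalIntegrable _ _)
      (hPc.intervalIntegrable _ _)
  have hjw : Continuous fun s => j (w s) := j.continuous.comp hw
  -- The first two terms are h² times the energy of the Steklov average; the last is the accumulated
  -- forcing bound. Only the primitive W passes through d, so no time derivative of w in V is
  -- needed.
  set G : ℝ → ℝ := fun s => ‖j (w (s + h)) - j (w s)‖ ^ 2 + ‖d (W (s + h) - W s)‖ ^ 2
    - 2 * Z * h * (R (s + h) - R s) with hG
  have hWc : Continuous W := continuous_iff_continuousAt.2 fun s => (hWd s).continuousAt
  have hRc : Continuous R := continuous_iff_continuousAt.2 fun s => (hRd s).continuousAt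
  have hGc : Continuous G := by
    have := d.continuous
    fun_prop
  have hGd : ∀ s ∈ Ioo t₀ (t₁ - h), HasDerivAt G
      (2 * inner ℝ (j (w (s + h)) - j (w s)) (z (s + h) - z s)
        + 2 * inner ℝ (d (W (s + h) - W s)) (d (w (s + h) - w s))
        - 2 * Z * h * (P (s + h) - P s)) s := by
    intro s hs
    have z1 : HasDerivAt (fun s => j (w s)) (z s) s :=
      (H.deriv s ⟨hs.1.le, by linarith [hs.2]⟩).hasDerivAt
        (Icc_mem_nhds hs.1 (by linarith [hs.2]))
    have z2 : HasDerivAt (fun s => j (w s)) (z (s + h)) (s + h) :=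
      (H.deriv (s + h) ⟨by linarith [hs.1], by linarith [hs.2]⟩).hasDerivAt
        (Icc_mem_nhds (by linarith [hs.1]) (by linarith [hs.2]))
    have e1 := ((z2.comp_add_const s h).sub z1).norm_sq
    have e2 := (d.hasFDerivAt.comp_hasDerivAt s
      (((hWd (s + h)).comp_add_const s h).sub (hWd s))).norm_sq
    have e3 := (((hRd (s + h)).comp_add_const s h).sub (hRd s)).const_mul (2 * Z * h)
    exact (e1.add e2).sub e3
  have hanti : AntitoneOn G (Icc t₀ (t₁ - h)) := by
    refine antitoneOn_of_deriv_nonpos (convex_Icc _ _) hGc.continuousOn ?_ ?_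
    · rw [interior_Icc]
      exact fun s hs => (hGd s hs).differentiableAt.differentiableWithinAt
    rw [interior_Icc]
    intro s hs
    rw [(hGd s hs).deriv]
    have hs0 : s ∈ Icc t₀ t₁ := ⟨hs.1.le, by linarith [hs.2]⟩
    have hs1 : s + h ∈ Icc t₀ t₁ := ⟨by linarith [hs.1], by linarith [hs.2]⟩
    -- This test element is the derivative of W(s+h) - W(s), and its pairing with the damping is
    -- B(D,D) ≥ 0.
    set D := w (s + h) - w s with hD
    have heq := H.equation s hs0 (s + h) hs1 D
    have hcont : Continuous fun r => (inner ℝ (d (w r)) (d D) : ℝ) := by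
      have := d.continuous
      fun_prop
    rw [intervalIntegral.integral_add (hcont.intervalIntegrable _ _)
      (H.forcing_integrable D s hs0 _ hs1)] at heq
    have hin : ∫ r in s..s + h, (inner ℝ (d (w r)) (d D) : ℝ) =
        inner ℝ (d (W (s + h) - W s)) (d D) := by
      rw [hWsub, real_inner_comm]
      have := ((innerSL ℝ (d D)).comp d).intervalIntegral_comp_comm
        (hw.intervalIntegrable (μ := volume) s (s + h))
      simp only [ContinuousLinearMap.comp_apply, innerSL_apply_apply] at this
      rw [← this]
      congr 1
      ext r
      rw [real_inner_comm]
    have hjD : ‖j D‖ ≤ Z * h := by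
      have := (convex_Icc t₀ t₁).norm_image_sub_le_of_norm_hasDerivWithin_le
        (fun r hr => H.deriv r hr) hZ hs0 hs1
      rw [hD, map_sub]
      simpa [abs_of_pos hh] using this
    have hℓ : |∫ r in s..s + h, ℓ r D| ≤ Z * h * (P (s + h) - P s) := by
      rw [hPsub, ← intervalIntegral.integral_const_mul]
      rw [← Real.norm_eq_abs]
      refine intervalIntegral.norm_integral_le_of_norm_le (by linarith) ?_
        ((hfi _ _).const_mul _)
      filter_upwards [H.forcing_le] with r hr hr'
      rw [Real.norm_eq_abs]
      refine (hr ⟨by linarith [hr'.1, hs.1], hr'.2.trans hs1.2⟩ D).trans ?_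
      rw [mul_comm]
      exact mul_le_mul_of_nonneg_right hjD (H.forcing_nonneg r)
    have hBD := H.nonneg D
    rw [hin] at heq
    rw [← map_sub, ← hD, real_inner_comm (z (s + h) - z s)]
    have := neg_le_of_abs_le hℓ
    linarith
  have hfin := hanti ⟨le_rfl, by linarith⟩ ⟨ht₀, by linarith⟩ ht₀
  have hQ0 : 0 ≤ R (t₀ + h) - R t₀ := by
    rw [hRsub]
    refine intervalIntegral.integral_nonneg (by linarith) fun r hr => ?_
    have : P t₀ = 0 := intervalIntegral.integral_same
    rw [← this]
    exact hPmono hr.1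
  -- Averaging the monotone P over length h supplies the second factor h, so the error is of order
  -- h² and survives division by h² as a fixed constant.
  have hQ1 : R (t + h) - R t ≤ h * P t₁ := by
    rw [hRsub]
    have := intervalIntegral.integral_mono_on (μ := volume) (by linarith : t ≤ t + h)
      (hPc.intervalIntegrable _ _) (continuous_const.intervalIntegrable _ _)
      fun r hr => hPmono (hr.2.trans ht₁)
    simpa using this
  simp only [hG] at hfin
  rw [← hWsub, ← hWsub, map_sub j, map_sub j]
  have h1 := mul_le_mul_of_nonneg_left hQ1 (by positivity : 0 ≤ 2 * Z * h)
  have h2 := mul_nonneg (by positivity : 0 ≤ 2 * Z * h) hQ0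
  change _ ≤ _ + 2 * Z * h ^ 2 * P t₁
  linarith

/-- The energy inequality. -/
theorem DampedEquation.energy_le [CompleteSpace V] (H : DampedEquation j d B w z ℓ f t₀ t₁)
    {Z : ℝ} (hZ : ∀ t ∈ Icc t₀ t₁, ‖z t‖ ≤ Z) {t : ℝ} (ht : t ∈ Ico t₀ t₁) :
    ‖z t‖ ^ 2 + ‖d (w t)‖ ^ 2 ≤ ‖z t₀‖ ^ 2 + ‖d (w t₀)‖ ^ 2 + 2 * Z * ∫ r in t₀..t₁, f r := by
  have lim : ∀ t ∈ Ico t₀ t₁, Tendsto (fun h => (h ^ 2)⁻¹ *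
      (‖j (w (t + h) - w t)‖ ^ 2 + ‖d (∫ r in t..t + h, w r)‖ ^ 2)) (𝓝[>] 0)
      (𝓝 (‖z t‖ ^ 2 + ‖d (w t)‖ ^ 2)) := by
    intro t ht
    have l1 := HasDerivWithinAt.tendsto_slope_zero_of_Icc ht (H.deriv t (Ico_subset_Icc_self ht))
    have l2 : Tendsto (fun h : ℝ => h⁻¹ • ∫ r in t..t + h, w r) (𝓝[>] 0) (𝓝 (w t)) := by
      have := (H.continuous.integral_hasStrictDerivAt t t).hasDerivAt.tendsto_slope_zero_right
      simpa using this
    have l3 := (d.continuous.tendsto _).comp l2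
    refine ((l1.norm.pow 2).add (l3.norm.pow 2)).congr fun h => ?_
    simp only [Function.comp_apply, map_smul, map_sub, norm_smul, mul_pow, norm_inv,
      Real.norm_eq_abs, inv_pow, sq_abs]
    ring
  have h0 : t₀ < t₁ := ht.1.trans_lt ht.2
  have hlim := (lim t₀ ⟨le_rfl, h0⟩).add
    (tendsto_const_nhds (x := 2 * Z * ∫ r in t₀..t₁, f r))
  refine le_of_tendsto_of_tendsto (lim t ht) hlim ?_
  filter_upwards [Ioc_mem_nhdsGT (sub_pos.2 ht.2)] with h hh
  have hh0 : h ≠ 0 := hh.1.ne'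
  have hh2 : 0 < h ^ 2 := pow_pos hh.1 2
  have := mul_le_mul_of_nonneg_left
    (H.steklov_energy_le hZ hh.1 ht.1 (by linarith [hh.2])) (inv_nonneg.2 hh2.le)
  refine this.trans (le_of_eq ?_)
  rw [mul_add]
  congr 1
  field_simp

end Energy

/-! ### Uniqueness from small forcing mass, and continuation in time. -/

section Energy

variable {V X Y : Type*} [NormedAddCommGroup V] [NormedSpace ℝ V]
  [NormedAddCommGroup X] [InnerProductSpace ℝ X] [NormedAddCommGroup Y] [InnerProductSpace ℝ Y]

variable {j : V →L[ℝ] X} {d : V →L[ℝ] Y} {B : V → V → ℝ} {w : ℝ → V}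
    {z : ℝ → X} {ℓ : ℝ → V → ℝ} {f m : ℝ → ℝ} {t₀ t₁ s₀ s₁ T : ℝ}

theorem DampedEquation.mono (H : DampedEquation j d B w z ℓ f t₀ t₁)
    (h : Icc s₀ s₁ ⊆ Icc t₀ t₁) : DampedEquation j d B w z ℓ f s₀ s₁ where
  continuous := H.continuous
  deriv t ht := (H.deriv t (h ht)).mono h
  nonneg := H.nonneg
  integrable := H.integrable
  forcing_nonneg := H.forcing_nonneg
  forcing_le := H.forcing_le.mono fun _ hr hr' => hr (h hr')
  forcing_integrable ψ s hs t ht := H.forcing_integrable ψ s (h hs) t (h ht)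
  equation s hs t ht := H.equation s (h hs) t (h ht)

/-- Uniqueness on an interval on which the forcing coefficient has small mass. -/
theorem DampedEquation.eq_zero_of_small [CompleteSpace V]
    (H : DampedEquation j d B w z ℓ (fun r => m r * ‖d (w r)‖) t₀ t₁) (h01 : t₀ ≤ t₁)
    (hm : ∀ r, 0 ≤ m r) (hmi : ∀ a b, IntervalIntegrable m volume a b)
    (hzc : ContinuousOn z (Icc t₀ t₁)) (hz0 : z t₀ = 0) (hw0 : d (w t₀) = 0)
    (hsmall : ∫ r in t₀..t₁, m r ≤ 1 / 4) {t : ℝ} (ht : t ∈ Icc t₀ t₁) :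
    z t = 0 ∧ d (w t) = 0 := by
  have hdw : Continuous fun t => d (w t) := d.continuous.comp H.continuous
  set e : ℝ → ℝ := fun t => ‖z t‖ ^ 2 + ‖d (w t)‖ ^ 2 with he
  have hec : ContinuousOn e (Icc t₀ t₁) := (hzc.norm.pow 2).add (hdw.norm.pow 2).continuousOn
  obtain ⟨τ, hτ, hmax⟩ := isCompact_Icc.exists_isMaxOn (nonempty_Icc.2 h01) hec
  set S := Real.sqrt (e τ) with hS
  have he0 : ∀ t, 0 ≤ e t := fun t => by positivity
  have hS2 : S ^ 2 = e τ := Real.sq_sqrt (he0 τ)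
  have hS0 : 0 ≤ S := Real.sqrt_nonneg _
  have hzS : ∀ t ∈ Icc t₀ t₁, ‖z t‖ ≤ S := fun t ht => Real.le_sqrt_of_sq_le <|
    (le_add_of_nonneg_right (sq_nonneg ‖d (w t)‖)).trans (hmax ht)
  have hdS : ∀ t ∈ Icc t₀ t₁, ‖d (w t)‖ ≤ S := fun t ht => Real.le_sqrt_of_sq_le <|
    (le_add_of_nonneg_left (sq_nonneg ‖z t‖)).trans (hmax ht)
  have hint : ∫ r in t₀..t₁, m r * ‖d (w r)‖ ≤ 1 / 4 * S := by
    refine (intervalIntegral.integral_mono_on h01 (H.integrable _ _) ((hmi _ _).mul_const S)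
      fun r hr => mul_le_mul_of_nonneg_left (hdS r hr) (hm r)).trans ?_
    rw [intervalIntegral.integral_mul_const]
    exact mul_le_mul_of_nonneg_right hsmall hS0
  -- With zero data the energy inequality gives 2 · S · (S/4) = S²/2. It holds on the half-open
  -- interval, where forward differences exist, and extends to the right endpoint by continuity.
  have hle : ∀ t ∈ Icc t₀ t₁, e t ≤ S ^ 2 / 2 := by
    have hico : ∀ t ∈ Ico t₀ t₁, e t ≤ S ^ 2 / 2 := fun t ht => by
      have := H.energy_le hzS ht
      rw [hz0, hw0] at this
      have h2 := mul_le_mul_of_nonneg_left hint (by positivity : 0 ≤ 2 * S)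
      simp only [norm_zero] at this
      simp only [he]
      linarith
    intro t ht
    rcases h01.eq_or_lt with rfl | hlt
    · have : t = t₀ := le_antisymm ht.2 ht.1
      simp only [he, this, hz0, hw0, norm_zero]
      have := sq_nonneg S
      linarith
    · have hcl := ContinuousWithinAt.closure_le (s := Ico t₀ t₁) (x := t)
        (by rwa [closure_Ico hlt.ne])
        ((hec t ht).mono Ico_subset_Icc_self) continuousWithinAt_const hico
      exact hcl
  have h1 := hle τ hτ
  have hτ0 : e τ = 0 := by linarith [he0 τ]
  have h2 : e t ≤ 0 := hτ0 ▸ hmax ht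
  have h3 : ‖z t‖ ^ 2 = 0 := by
    have := sq_nonneg ‖z t‖
    have := sq_nonneg ‖d (w t)‖
    simp only [he] at h2
    linarith
  have h4 : ‖d (w t)‖ ^ 2 = 0 := by
    have := sq_nonneg ‖z t‖
    have := sq_nonneg ‖d (w t)‖
    simp only [he] at h2
    linarith
  exact ⟨norm_eq_zero.1 (pow_eq_zero_iff two_ne_zero |>.1 h3),
    norm_eq_zero.1 (pow_eq_zero_iff two_ne_zero |>.1 h4)⟩

/-- Uniqueness for the damped equation with zero data and forcing controlled by the energy. -/
theorem DampedEquation.eq_zero [CompleteSpace V]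
    (H : DampedEquation j d B w z ℓ (fun r => m r * ‖d (w r)‖) 0 T)
    (hm : ∀ r, 0 ≤ m r) (hmi : ∀ a b, IntervalIntegrable m volume a b)
    (hzc : ContinuousOn z (Icc 0 T)) (hz0 : z 0 = 0) (hw0 : d (w 0) = 0)
    {t : ℝ} (ht : t ∈ Icc 0 T) : z t = 0 ∧ d (w t) = 0 := by
  have hdw : Continuous fun t => d (w t) := d.continuous.comp H.continuous
  have hclosed : IsClosed ({t | z t = 0 ∧ d (w t) = 0} ∩ Icc 0 T) := by
    have h1 : IsClosed (Icc 0 T ∩ z ⁻¹' {0}) :=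
      hzc.preimage_isClosed_of_isClosed isClosed_Icc isClosed_singleton
    have h2 : IsClosed ((fun t => d (w t)) ⁻¹' {0}) := isClosed_singleton.preimage hdw
    convert! h1.inter h2 using 1
    ext t
    simp only [mem_inter_iff, mem_ofPred_eq, mem_preimage, mem_singleton_iff]
    tauto
  -- Continuous induction: the vanishing set is closed, and from each of its points it extends to
  -- the right because the primitive of m is continuous.
  refine hclosed.Icc_subset_of_forall_exists_gt ⟨hz0, hw0⟩ ?_ ht
  rintro x ⟨⟨hzx, hwx⟩, hx⟩ y hy
  have hcont : Continuous fun s => ∫ r in x..s, m r := intervalIntegral.continuous_primitive hmi x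
  have hev : ∀ᶠ s in 𝓝[>] x, ∫ r in x..s, m r < 1 / 4 := by
    refine ((hcont.tendsto x).mono_left nhdsWithin_le_nhds).eventually_lt_const ?_
    simp
  obtain ⟨s, hs, hs1, hs2⟩ := (hev.and ((Ioc_mem_nhdsGT (lt_min hy hx.2)))).exists
  have hsy := hs2.trans (min_le_left _ _)
  have hsT := hs2.trans (min_le_right _ _)
  have hsub : Icc x s ⊆ Icc 0 T := Icc_subset_Icc hx.1 hsT
  exact ⟨s, (H.mono hsub).eq_zero_of_small hs1.le hm hmi (hzc.mono hsub) hzx hwx hs.le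
    ⟨hs1.le, le_rfl⟩, hs1, hsy⟩

end Energy

/-! ### Hölder estimates for the quintic nonlinearity. -/

theorem abs_pow_five_sub_le (a b : ℝ) :
    |a ^ 5 - b ^ 5| ≤ 5 * ((|a| ^ 4 + |b| ^ 4) * |a - b|) := by
  have h : a ^ 5 - b ^ 5 = (a ^ 4 + a ^ 3 * b + a ^ 2 * b ^ 2 + a * b ^ 3 + b ^ 4) * (a - b) := by
    ring
  rw [h, abs_mul, ← mul_assoc]
  refine mul_le_mul_of_nonneg_right ?_ (abs_nonneg _)
  have key : ∀ x y : ℝ, 0 ≤ x → 0 ≤ y → x ^ 4 + x ^ 3 * y + x ^ 2 * y ^ 2 + x * y ^ 3 + y ^ 4 ≤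
      5 * (x ^ 4 + y ^ 4) := by
    intro x y hx hy
    have h1 : x ^ 3 * y ≤ x ^ 4 + y ^ 4 := by
      nlinarith [sq_nonneg (x ^ 2 - x * y), sq_nonneg (x ^ 2 - y ^ 2), sq_nonneg (x * y)]
    have h2 : x ^ 2 * y ^ 2 ≤ x ^ 4 + y ^ 4 := by
      nlinarith [sq_nonneg (x ^ 2 - y ^ 2), sq_nonneg (x * y)]
    have h3 : x * y ^ 3 ≤ x ^ 4 + y ^ 4 := by
      nlinarith [sq_nonneg (y ^ 2 - x * y), sq_nonneg (x ^ 2 - y ^ 2), sq_nonneg (x * y)]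
    have := pow_nonneg hx 4
    have := pow_nonneg hy 4
    linarith
  refine le_trans ?_ (key |a| |b| (abs_nonneg _) (abs_nonneg _))
  refine (abs_add_le _ _).trans (add_le_add ((abs_add_le _ _).trans (add_le_add
    ((abs_add_le _ _).trans (add_le_add ((abs_add_le _ _).trans (add_le_add ?_ ?_)) ?_)) ?_)) ?_)
  all_goals simp [abs_mul, abs_pow]

section Holder

variable {α : Type*} [MeasurableSpace α] {μ : Measure α} {P Q : ℝ≥0∞}

/-- Three-factor Hölder, with P and Q left free because two choices are needed: P = Q = 6 gives
continuity on H_0^1, while P = 12, Q = 2 gives the uniqueness estimate. -/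
theorem lintegral_quartic_mul_le (hP0 : P ≠ 0) (hP : P ≠ ⊤) (hQ0 : Q ≠ 0) (hQ : Q ≠ ⊤)
    (hPQ : 4 / P.toReal + 1 / 6 + 1 / Q.toReal = 1) {f w ψ : α → ℝ}
    (hf : AEStronglyMeasurable f μ) (hw : AEStronglyMeasurable w μ)
    (hψ : AEStronglyMeasurable ψ μ) :
    ∫⁻ x, ‖f x‖ₑ ^ 4 * ‖w x‖ₑ * ‖ψ x‖ₑ ∂μ ≤
      eLpNorm f P μ ^ 4 * eLpNorm w 6 μ * eLpNorm ψ Q μ := by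
  have hP' : P.toReal ≠ 0 := (ENNReal.toReal_pos hP0 hP).ne'
  have hQ' : Q.toReal ≠ 0 := (ENNReal.toReal_pos hQ0 hQ).ne'
  -- Each factor is first raised to its full Lebesgue exponent, so that the weights are 4/P, 1/6,
  -- 1/Q and sum to one.
  have key := ENNReal.lintegral_prod_norm_pow_le (μ := μ) (Finset.univ : Finset (Fin 3))
    (f := ![fun x => ‖f x‖ₑ ^ P.toReal, fun x => ‖w x‖ₑ ^ (6 : ℝ), fun x => ‖ψ x‖ₑ ^ Q.toReal])
    (p := ![4 / P.toReal, 1 / 6, 1 / Q.toReal])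
    (by
      intro i _
      fin_cases i
      · exact hf.enorm.pow_const _
      · exact hw.enorm.pow_const _
      · exact hψ.enorm.pow_const _)
    (by simpa [Fin.sum_univ_three] using hPQ)
    (by
      intro i _
      fin_cases i <;> (simp; try positivity))
  simp only [Fin.prod_univ_three, Matrix.cons_val_zero, Matrix.cons_val_one, Matrix.cons_val,
    ← ENNReal.rpow_mul, mul_div_cancel₀ _ hP', mul_div_cancel₀ _ hQ'] at key
  rw [eLpNorm_eq_lintegral_rpow_enorm_toReal hP0 hP,
    eLpNorm_eq_lintegral_rpow_enorm_toReal hQ0 hQ,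
    eLpNorm_eq_lintegral_rpow_enorm_toReal (p := 6) (by norm_num) (by norm_num),
    ← ENNReal.rpow_natCast (_ ^ (1 / P.toReal)), ← ENNReal.rpow_mul,
    show 1 / P.toReal * ((4 : ℕ) : ℝ) = 4 / P.toReal by push_cast; ring]
  refine le_trans (le_of_eq ?_) (key.trans (le_of_eq ?_))
  · refine lintegral_congr fun x => ?_
    rw [mul_div_cancel₀ _ (by norm_num : (6 : ℝ) ≠ 0)]
    simp only [ENNReal.rpow_one]
    rw [← ENNReal.rpow_natCast]
    norm_num
  · norm_num

/-- Hölder's inequality for the difference of two quintic nonlinearities. -/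
theorem lintegral_quintic_sub_mul_le (hP0 : P ≠ 0) (hP : P ≠ ⊤) (hQ0 : Q ≠ 0) (hQ : Q ≠ ⊤)
    (hPQ : 4 / P.toReal + 1 / 6 + 1 / Q.toReal = 1) {f g ψ : α → ℝ}
    (hf : AEStronglyMeasurable f μ) (hg : AEStronglyMeasurable g μ)
    (hψ : AEStronglyMeasurable ψ μ) :
    ∫⁻ x, ‖(f x ^ 5 - g x ^ 5) * ψ x‖ₑ ∂μ ≤
      5 * ((eLpNorm f P μ ^ 4 + eLpNorm g P μ ^ 4) * eLpNorm (f - g) 6 μ * eLpNorm ψ Q μ) := by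
  have hpt : ∀ x, ‖(f x ^ 5 - g x ^ 5) * ψ x‖ₑ ≤
      5 * (‖f x‖ₑ ^ 4 * ‖(f - g) x‖ₑ * ‖ψ x‖ₑ + ‖g x‖ₑ ^ 4 * ‖(f - g) x‖ₑ * ‖ψ x‖ₑ) := by
    intro x
    have h := abs_pow_five_sub_le (f x) (g x)
    have h' : ‖f x ^ 5 - g x ^ 5‖ₑ ≤ 5 * ((‖f x‖ₑ ^ 4 + ‖g x‖ₑ ^ 4) * ‖f x - g x‖ₑ) := by
      simp only [← ofReal_norm, Real.norm_eq_abs]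
      rw [← ENNReal.ofReal_pow (abs_nonneg _), ← ENNReal.ofReal_pow (abs_nonneg _),
        ← ENNReal.ofReal_add (by positivity) (by positivity), ← ENNReal.ofReal_mul (by positivity),
        show (5 : ℝ≥0∞) = ENNReal.ofReal 5 by simp, ← ENNReal.ofReal_mul (by positivity)]
      exact ENNReal.ofReal_le_ofReal h
    rw [enorm_mul, Pi.sub_apply]
    refine (mul_le_mul_left h' _).trans (le_of_eq ?_)
    ring
  have hm : AEMeasurable (fun x => ‖f x‖ₑ ^ 4 * ‖(f - g) x‖ₑ * ‖ψ x‖ₑ) μ :=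
    ((hf.enorm.pow_const 4).mul (hf.sub hg).enorm).mul hψ.enorm
  refine (lintegral_mono hpt).trans ?_
  rw [lintegral_const_mul' _ _ (by norm_num), lintegral_add_left' hm]
  gcongr
  rw [add_mul, add_mul]
  exact add_le_add (lintegral_quartic_mul_le hP0 hP hQ0 hQ hPQ hf (hf.sub hg) hψ)
    (lintegral_quartic_mul_le hP0 hP hQ0 hQ hPQ hg (hf.sub hg) hψ)

theorem integrable_quintic_sub_mul (hP0 : P ≠ 0) (hP : P ≠ ⊤) (hQ0 : Q ≠ 0) (hQ : Q ≠ ⊤)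
    (hPQ : 4 / P.toReal + 1 / 6 + 1 / Q.toReal = 1) {f g ψ : α → ℝ}
    (hf : MemLp f P μ) (hg : MemLp g P μ) (hfg : MemLp (f - g) 6 μ) (hψ : MemLp ψ Q μ) :
    Integrable (fun x => (f x ^ 5 - g x ^ 5) * ψ x) μ := by
  refine ⟨((hf.1.pow 5).sub (hg.1.pow 5)).mul hψ.1, ?_⟩
  refine (lintegral_quintic_sub_mul_le hP0 hP hQ0 hQ hPQ hf.1 hg.1 hψ.1).trans_lt ?_
  have h1 := hf.2
  have h2 := hg.2
  have h3 := hfg.2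
  have h4 := hψ.2
  finiteness

theorem abs_integral_quintic_sub_mul_le (hP0 : P ≠ 0) (hP : P ≠ ⊤) (hQ0 : Q ≠ 0) (hQ : Q ≠ ⊤)
    (hPQ : 4 / P.toReal + 1 / 6 + 1 / Q.toReal = 1) {f g ψ : α → ℝ}
    (hf : MemLp f P μ) (hg : MemLp g P μ) (hfg : MemLp (f - g) 6 μ) (hψ : MemLp ψ Q μ) :
    |∫ x, (f x ^ 5 - g x ^ 5) * ψ x ∂μ| ≤
      5 * (((eLpNorm f P μ).toReal ^ 4 + (eLpNorm g P μ).toReal ^ 4) *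
        (eLpNorm (f - g) 6 μ).toReal * (eLpNorm ψ Q μ).toReal) := by
  have h1 := hf.2
  have h2 := hg.2
  have h3 := hfg.2
  have h4 := hψ.2
  have := ENNReal.toReal_mono (by finiteness)
    (lintegral_quintic_sub_mul_le hP0 hP hQ0 hQ hPQ hf.1 hg.1 hψ.1)
  rw [ENNReal.toReal_mul, ENNReal.toReal_mul, ENNReal.toReal_mul,
    ENNReal.toReal_add (by finiteness) (by finiteness), ENNReal.toReal_pow,
    ENNReal.toReal_pow] at this
  rw [← Real.norm_eq_abs]
  refine (norm_integral_le_lintegral_norm _).trans ?_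
  simpa only [ofReal_norm, ENNReal.toReal_ofNat] using this

end Holder

/-! ### The Sobolev inequality on H_0^1(Ω). -/

section Sobolev

variable {Ω : Set E3}

/-- The inclusion `H_0^1(Ω) → L²(Ω)`. -/
def H10.fnL (Ω : Set E3) : H10 Ω →L[ℝ] L2 Ω :=
  (WithLp.fstL 2 ℝ (L2 Ω) (L2Vec Ω)).comp (testGraph Ω).topologicalClosure.subtypeL

/-- The gradient `H_0^1(Ω) → L²(Ω; ℝ³)`. -/
def H10.gradL (Ω : Set E3) : H10 Ω →L[ℝ] L2Vec Ω :=
  (WithLp.sndL 2 ℝ (L2 Ω) (L2Vec Ω)).comp (testGraph Ω).topologicalClosure.subtypeL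

theorem H10.fnL_apply (p : H10 Ω) : H10.fnL Ω p = p.fn := rfl

theorem H10.gradL_apply (p : H10 Ω) : H10.gradL Ω p = p.grad := rfl

theorem norm_gradient (φ : E3 → ℝ) (x : E3) : ‖gradient φ x‖ = ‖fderiv ℝ φ x‖ := by
  rw [gradient, LinearIsometryEquiv.norm_map]

theorem support_gradient_subset (φ : E3 → ℝ) :
    Function.support (gradient φ) ⊆ tsupport φ := by
  intro x hx
  refine support_fderiv_subset ℝ (f := φ) ?_
  rw [Function.mem_support, ← norm_ne_zero_iff, ← norm_gradient, norm_ne_zero_iff]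
  exact hx

/-- The constant of the Sobolev inequality for `H_0^1 ⊂ L⁶` in dimension three. -/
def sobolevConst : NNReal := eLpNormLESNormFDerivOfEqInnerConst (volume : Measure E3) 2

/-- Gagliardo–Nirenberg–Sobolev on the whole space, where 1/6 = 1/2 - 1/3. The gradient is supported
in Ω, so restricting its norm to Ω loses nothing. -/
theorem IsTestFunction.eLpNorm_six_le {φ : E3 → ℝ} (hφ : IsTestFunction Ω φ) :
    eLpNorm φ 6 (volume.restrict Ω) ≤
      sobolevConst * eLpNorm (gradient φ) 2 (volume.restrict Ω) := by
  have h := eLpNorm_le_eLpNorm_fderiv_of_eq_inner (volume : Measure E3) (u := φ)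
    (hφ.smooth.of_le (by simp)) hφ.compact (p := 2) (p' := 6) (by norm_num) (by simp)
    (by simp; norm_num)
  refine (eLpNorm_mono_measure _ Measure.restrict_le_self).trans (h.trans (le_of_eq ?_))
  rw [eLpNorm_restrict_eq_of_support_subset ((support_gradient_subset φ).trans hφ.support)]
  congr 1
  exact (eLpNorm_congr_norm_ae (Eventually.of_forall fun x => norm_gradient φ x)).symm

/-- The Sobolev inequality in `H_0^1(Ω)`. -/
theorem H10.eLpNorm_six_le (p : H10 Ω) :
    eLpNorm p.fn 6 (volume.restrict Ω) ≤ sobolevConst * eLpNorm p.grad 2 (volume.restrict Ω) := by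
  obtain ⟨q, hq, hlim⟩ := mem_closure_iff_seq_limit.1 p.2
  have hfst : Tendsto (fun n => (q n).fst) atTop (𝓝 p.fn) :=
    ((WithLp.fstL 2 ℝ (L2 Ω) (L2Vec Ω)).continuous.tendsto _).comp hlim
  have hsnd : Tendsto (fun n => (q n).snd) atTop (𝓝 p.grad) :=
    ((WithLp.sndL 2 ℝ (L2 Ω) (L2Vec Ω)).continuous.tendsto _).comp hlim
  -- An a.e. convergent subsequence allows Fatou's lemma to pass the L⁶ bound to the limit.
  obtain ⟨ns, hns, hae⟩ := (tendstoInMeasure_of_tendsto_Lp hfst).exists_seq_tendsto_ae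
  have hle : ∀ n, eLpNorm (q n).fst 6 (volume.restrict Ω) ≤ sobolevConst * ‖(q n).snd‖ₑ := by
    intro n
    obtain ⟨φ, hφ, h1, h2⟩ := hq n
    rw [Lp.enorm_def, eLpNorm_congr_ae h1, eLpNorm_congr_ae h2]
    exact hφ.eLpNorm_six_le
  have hl : Tendsto (fun n => (sobolevConst : ℝ≥0∞) * ‖(q (ns n)).snd‖ₑ) atTop
      (𝓝 (sobolevConst * ‖p.grad‖ₑ)) :=
    ENNReal.Tendsto.const_mul ((hsnd.comp hns.tendsto_atTop).enorm) (Or.inr (by simp))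
  rw [← Lp.enorm_def, ← hl.liminf_eq]
  refine (Lp.eLpNorm_lim_le_liminf_eLpNorm (fun n => Lp.aestronglyMeasurable _) _ hae).trans ?_
  exact liminf_le_liminf (Eventually.of_forall fun n => hle (ns n))

theorem H10.memLp_six (p : H10 Ω) : MemLp p.fn 6 (volume.restrict Ω) :=
  ⟨Lp.aestronglyMeasurable _, p.eLpNorm_six_le.trans_lt
    (ENNReal.mul_lt_top (by simp) (Lp.eLpNorm_lt_top _))⟩

theorem H10.toReal_eLpNorm_six_le (p : H10 Ω) :
    (eLpNorm p.fn 6 (volume.restrict Ω)).toReal ≤ sobolevConst * ‖p.grad‖ := by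
  have := ENNReal.toReal_mono (ENNReal.mul_lt_top (by simp) (Lp.eLpNorm_lt_top p.grad)).ne
    p.eLpNorm_six_le
  rwa [ENNReal.toReal_mul, ENNReal.coe_toReal] at this

theorem H10.norm_grad_le (p : H10 Ω) : ‖p.grad‖ ≤ ‖p‖ :=
  WithLp.norm_snd_le (x := p.1) ..

theorem H10.grad_sub (p q : H10 Ω) : (p - q).grad = p.grad - q.grad := rfl

/-- An element of `H_0^1(Ω)` with zero gradient vanishes. -/
theorem H10.eq_zero_of_grad_eq_zero {p : H10 Ω} (h : p.grad = 0) : p = 0 := by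
  have h6 := p.eLpNorm_six_le
  rw [← Lp.enorm_def, h, enorm_zero, mul_zero, nonpos_iff_eq_zero,
    eLpNorm_eq_zero_iff (Lp.aestronglyMeasurable _) (by norm_num)] at h6
  have hfn : p.fn = 0 := (Lp.eq_zero_iff_ae_eq_zero).2 h6
  exact Subtype.ext (WithLp.ofLp_injective 2 (Prod.ext hfn h))

end Sobolev

/-! ### From test functions to all test elements. -/

section Density

variable {V : Type*} [NormedAddCommGroup V] {T : ℝ}

/-- A distributional identity `G' = -F` tested with a dense set of elements holds in integrated
form for all elements. -/
theorem integrated_of_weak (hT : 0 < T) {S : Set V} {G F : ℝ → V → ℝ} {M : ℝ} (hS : Dense S)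
    (hG : ∀ q, ContinuousOn (fun t => G t q) (Icc 0 T)) (hG' : ∀ t, Continuous (G t))
    (hF : ∀ q, ContinuousOn (fun t => F t q) (Icc 0 T))
    (hF' : ∀ t ∈ Icc 0 T, ∀ q q', |F t q - F t q'| ≤ M * ‖q - q'‖)
    (h : ∀ q ∈ S, ∀ θ, IsTimeTest T θ →
      ∫ t in Ioo 0 T, (-(deriv θ t * G t q) + θ t * F t q) = 0)
    {s t : ℝ} (hs : s ∈ Icc 0 T) (ht : t ∈ Icc 0 T) (q : V) :
    G t q - G s q + ∫ r in s..t, F r q = 0 := by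
  have hFi : ∀ q, IntervalIntegrable (fun r => F r q) volume s t := fun q =>
    ((hF q).mono (uIcc_subset_Icc hs ht)).intervalIntegrable
  have hc : Continuous fun q => ∫ r in s..t, F r q := by
    refine continuous_iff_continuousAt.2 fun q => ?_
    rw [ContinuousAt, tendsto_iff_norm_sub_tendsto_zero]
    refine squeeze_zero (g := fun q' => M * ‖q' - q‖ * |t - s|) (fun _ => norm_nonneg _)
      (fun q' => ?_) ?_
    · rw [← intervalIntegral.integral_sub (hFi q') (hFi q)]
      exact intervalIntegral.norm_integral_le_of_norm_le_const fun r hr =>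
        hF' r (uIcc_subset_Icc hs ht (uIoc_subset_uIcc hr)) q' q
    · have : Continuous fun q' => M * ‖q' - q‖ * |t - s| := by fun_prop
      simpa using this.tendsto q
  refine hS.induction (P := fun q => G t q - G s q + ∫ r in s..t, F r q = 0)
    (fun q hq => sub_eq_neg_integral_of_weak_deriv hT (hG q) (hF q) (h q hq) hs ht)
    (isClosed_eq (((hG' t).sub (hG' s)).add hc) continuous_const) q

end Density

/-! ### The functionals of the weak formulation on H_0^1(Ω). -/

section Functionals

variable {Ω : Set E3}

/-- The quintic pairing `∫ p⁵ q` on `H_0^1(Ω)`. -/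
def H10.quintic (p q : H10 Ω) : ℝ := ∫ x in Ω, p.fn x ^ 5 * q.fn x

theorem H10.integrable_quintic (p q : H10 Ω) :
    Integrable (fun x => p.fn x ^ 5 * q.fn x) (volume.restrict Ω) := by
  simpa using integrable_quintic_sub_mul (P := 6) (Q := 6) (by norm_num) (by norm_num)
    (by norm_num) (by norm_num) (by norm_num) p.memLp_six (MemLp.zero (ε := ℝ))
    (by simpa using p.memLp_six) q.memLp_six

theorem H10.quintic_sub_apply (p p' q : H10 Ω) :
    p.quintic q - p'.quintic q = ∫ x in Ω, (p.fn x ^ 5 - p'.fn x ^ 5) * q.fn x := by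
  rw [quintic, quintic, ← integral_sub (p.integrable_quintic q)
    (p'.integrable_quintic q)]
  simp only [sub_mul]

theorem H10.memLp_six_sub (p p' : H10 Ω) : MemLp (⇑p.fn - ⇑p'.fn) 6 (volume.restrict Ω) :=
  p.memLp_six.sub p'.memLp_six

theorem H10.toReal_eLpNorm_six_sub_le (p p' : H10 Ω) :
    (eLpNorm (⇑p.fn - ⇑p'.fn) 6 (volume.restrict Ω)).toReal ≤
      sobolevConst * ‖(p - p').grad‖ := by
  rw [← eLpNorm_congr_ae (Lp.coeFn_sub p.fn p'.fn)]
  exact (p - p').toReal_eLpNorm_six_le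

theorem H10.quintic_sub_right (p q q' : H10 Ω) :
    p.quintic q - p.quintic q' = p.quintic (q - q') := by
  rw [quintic, quintic, quintic, ← integral_sub (p.integrable_quintic q)
    (p.integrable_quintic q')]
  refine integral_congr_ae ?_
  filter_upwards [Lp.coeFn_sub q.fn q'.fn] with x hx
  have : (q - q').fn x = q.fn x - q'.fn x := hx
  rw [this]
  ring

theorem H10.quintic_zero_left (q : H10 Ω) : (0 : H10 Ω).quintic q = 0 := by
  refine (integral_congr_ae ?_).trans (integral_zero _ _)
  filter_upwards [Lp.coeFn_zero ℝ 2 (volume.restrict Ω)] with x hx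
  have : (0 : H10 Ω).fn x = 0 := hx
  rw [this]
  ring

/-- All factors are placed in L⁶, so this holds in the energy space alone and makes the quintic
pairing continuous in its first argument. -/
theorem H10.abs_quintic_sub_le (p p' q : H10 Ω) :
    |p.quintic q - p'.quintic q| ≤ 5 * (((sobolevConst * ‖p‖) ^ 4 + (sobolevConst * ‖p'‖) ^ 4) *
      (sobolevConst * ‖p - p'‖) * (sobolevConst * ‖q‖)) := by
  have h := abs_integral_quintic_sub_mul_le (P := 6) (Q := 6) (by norm_num) (by norm_num)
    (by norm_num) (by norm_num) (by norm_num) p.memLp_six p'.memLp_six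
    (p.memLp_six_sub p') q.memLp_six
  have h6 : ∀ q : H10 Ω, (eLpNorm q.fn 6 (volume.restrict Ω)).toReal ≤ sobolevConst * ‖q‖ :=
    fun q => q.toReal_eLpNorm_six_le.trans (by gcongr; exact q.norm_grad_le)
  have hs : (eLpNorm (⇑p.fn - ⇑p'.fn) 6 (volume.restrict Ω)).toReal ≤ sobolevConst * ‖p - p'‖ :=
    (p.toReal_eLpNorm_six_sub_le p').trans (by gcongr; exact (p - p').norm_grad_le)
  rw [quintic_sub_apply]
  refine h.trans ?_
  have := mul_le_mul (mul_le_mul (add_le_add (pow_le_pow_left₀ ENNReal.toReal_nonneg (h6 p) 4)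
    (pow_le_pow_left₀ ENNReal.toReal_nonneg (h6 p') 4)) hs
    ENNReal.toReal_nonneg (by positivity)) (h6 q) ENNReal.toReal_nonneg (by positivity)
  linarith

theorem H10.continuous_quintic (q : H10 Ω) : Continuous fun p : H10 Ω => p.quintic q := by
  refine continuous_iff_continuousAt.2 fun p => ?_
  rw [ContinuousAt, tendsto_iff_norm_sub_tendsto_zero]
  refine squeeze_zero (fun _ => norm_nonneg _) (fun p' => p'.abs_quintic_sub_le p q) ?_
  have hc : Continuous fun p' : H10 Ω => 5 * (((sobolevConst * ‖p'‖) ^ 4 +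
      (sobolevConst * ‖p‖) ^ 4) * (sobolevConst * ‖p' - p‖) * (sobolevConst * ‖q‖)) := by
    fun_prop
  have := hc.tendsto p
  simpa using this

/-- The damping operator `g ↦ a g` on `L²(Ω; ℝ³)`. -/
def dampingOp {a : E3 → ℝ} (ha : MemLp a ⊤ (volume.restrict Ω)) : L2Vec Ω →L[ℝ] L2Vec Ω :=
  (ContinuousLinearMap.lsmul ℝ ℝ : ℝ →L[ℝ] E3 →L[ℝ] E3).holderL (volume.restrict Ω) ⊤ 2 2
    (ha.toLp a)

theorem coeFn_dampingOp {a : E3 → ℝ} (ha : MemLp a ⊤ (volume.restrict Ω)) (g : L2Vec Ω) :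
    dampingOp ha g =ᵐ[volume.restrict Ω] fun x => a x • g x := by
  have h1 := (ContinuousLinearMap.lsmul ℝ ℝ : ℝ →L[ℝ] E3 →L[ℝ] E3).coeFn_holder (r := 2)
    (ha.toLp a) g
  filter_upwards [h1, ha.coeFn_toLp] with x hx hx'
  rw [hx'] at hx
  exact hx

theorem inner_dampingOp_self_nonneg {a : E3 → ℝ} (ha : MemLp a ⊤ (volume.restrict Ω))
    (ha0 : ∀ᵐ x ∂(volume.restrict Ω), 0 ≤ a x) (g : L2Vec Ω) :
    0 ≤ (inner ℝ (dampingOp ha g) g : ℝ) := by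
  rw [L2.inner_def]
  refine integral_nonneg_of_ae ?_
  filter_upwards [coeFn_dampingOp ha g, ha0] with x hx hx0
  rw [hx, real_inner_smul_left]
  exact mul_nonneg hx0 real_inner_self_nonneg

/-- The pairing `∫ z q + ∫ a ∇p·∇q`. -/
def momentum {a : E3 → ℝ} (ha : MemLp a ⊤ (volume.restrict Ω)) (z : L2 Ω) (p q : H10 Ω) : ℝ :=
  inner ℝ z q.fn + inner ℝ (dampingOp ha p.grad) q.grad

/-- The pairing `∫ ∇p·∇q + ∫ p⁵ q`. -/
def H10.force (p q : H10 Ω) : ℝ := inner ℝ p.grad q.grad + p.quintic q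

theorem H10.continuous_fn : Continuous (H10.fn : H10 Ω → L2 Ω) := (H10.fnL Ω).continuous

theorem H10.continuous_grad : Continuous (H10.grad : H10 Ω → L2Vec Ω) := (H10.gradL Ω).continuous

theorem H10.continuous_force (q : H10 Ω) : Continuous fun p : H10 Ω => p.force q :=
  (H10.continuous_grad.inner continuous_const).add (H10.continuous_quintic q)

/-- The Lipschitz constant depends only on ‖p‖. It is therefore uniform along a bounded trajectory,
as the density argument requires. -/
theorem H10.abs_force_sub_le (p q q' : H10 Ω) :
    |p.force q - p.force q'| ≤ (‖p‖ + 5 * (sobolevConst * ‖p‖) ^ 5 * sobolevConst) * ‖q - q'‖ := by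
  have h1 : p.force q - p.force q' = inner ℝ p.grad (q - q').grad + p.quintic (q - q') := by
    rw [force, force, ← quintic_sub_right, grad_sub, inner_sub_right]
    ring
  have h2 := p.abs_quintic_sub_le 0 (q - q')
  rw [quintic_zero_left, norm_zero, sub_zero, sub_zero] at h2
  have h3 : |(inner ℝ p.grad (q - q').grad : ℝ)| ≤ ‖p‖ * ‖q - q'‖ :=
    (abs_real_inner_le_norm _ _).trans (mul_le_mul p.norm_grad_le (q - q').norm_grad_le
      (norm_nonneg _) (norm_nonneg _))
  rw [h1]
  refine (abs_add_le _ _).trans ((add_le_add h3 h2).trans (le_of_eq ?_))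
  ring

end Functionals

/-! ### The equation integrated in time. -/

section Weak

variable {Ω : Set E3} {T : ℝ}

theorem IsTimeTest.mul_isTestFunction {θ : ℝ → ℝ} {φ : E3 → ℝ} (hθ : IsTimeTest T θ)
    (hφ : IsTestFunction Ω φ) : IsSpaceTimeTest T Ω fun p => θ p.1 * φ p.2 := by
  have hs : Function.support (fun p : ℝ × E3 => θ p.1 * φ p.2) ⊆ tsupport θ ×ˢ tsupport φ :=
    fun p hp => ⟨subset_tsupport _ (left_ne_zero_of_mul hp),
      subset_tsupport _ (right_ne_zero_of_mul hp)⟩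
  refine ⟨(hθ.smooth.comp contDiff_fst).mul (hφ.smooth.comp contDiff_snd),
    HasCompactSupport.of_support_subset_isCompact (hθ.compact.isCompact.prod hφ.compact.isCompact) hs,
    (closure_minimal hs ((isClosed_tsupport _).prod (isClosed_tsupport _))).trans
      (prod_mono hθ.support hφ.support)⟩

theorem gradient_const_mul_of_contDiff {φ : E3 → ℝ} (hφ : ContDiff ℝ ∞ φ) (c : ℝ) (x : E3) :
    gradient (fun y => c * φ y) x = c • gradient φ x := by
  have : DifferentiableAt ℝ φ x := hφ.differentiable (by simp) x
  rw [gradient, fderiv_const_mul this, map_smul, gradient]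

/-- The weak formulation tested with a product `θ(t) φ(x)`. -/
theorem SolvesWeakly.integral_test {a : E3 → ℝ} (ha : MemLp a ⊤ (volume.restrict Ω))
    {u : ℝ → H10 Ω} (hu : SolvesWeakly a T u) {q : H10 Ω} (hq : q.1 ∈ testGraph Ω)
    {θ : ℝ → ℝ} (hθ : IsTimeTest T θ) :
    ∫ t in Ioo 0 T, (-(deriv θ t * momentum ha (timeDeriv T u t) (u t) q)
      + θ t * (u t).force q) = 0 := by
  obtain ⟨φ, hφ, h1, h2⟩ := hq
  have h1 : q.fn =ᵐ[volume.restrict Ω] φ := h1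
  have h2 : q.grad =ᵐ[volume.restrict Ω] gradient φ := h2
  refine Eq.trans ?_ (hu _ (hθ.mul_isTestFunction hφ))
  refine setIntegral_congr_fun measurableSet_Ioo fun t _ => ?_
  have hd : ∀ x : E3, deriv (fun s => θ s * φ x) t = deriv θ t * φ x := fun x =>
    deriv_mul_const (hθ.smooth.differentiable (by simp) t) _
  simp only [hd, gradient_const_mul_of_contDiff hφ.smooth, real_inner_smul_right, momentum,
    H10.force, H10.quintic, L2.inner_def]
  have e1 : ∫ x in Ω, timeDeriv T u t x * (deriv θ t * φ x) =
      deriv θ t * ∫ x in Ω, (inner ℝ (timeDeriv T u t x) (q.fn x) : ℝ) := by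
    rw [← integral_const_mul]
    refine integral_congr_ae ?_
    filter_upwards [h1] with x hx
    rw [hx, RCLike.inner_apply, conj_trivial]
    ring
  have e2 : ∫ x in Ω, θ t * (inner ℝ ((u t).grad x) (gradient φ x) : ℝ) =
      θ t * ∫ x in Ω, (inner ℝ ((u t).grad x) (q.grad x) : ℝ) := by
    rw [← integral_const_mul]
    refine integral_congr_ae ?_
    filter_upwards [h2] with x hx
    rw [hx]
  have e3 : ∫ x in Ω, a x * (deriv θ t * (inner ℝ ((u t).grad x) (gradient φ x) : ℝ)) =
      deriv θ t * ∫ x in Ω, (inner ℝ (dampingOp ha (u t).grad x) (q.grad x) : ℝ) := by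
    rw [← integral_const_mul]
    refine integral_congr_ae ?_
    filter_upwards [h2, coeFn_dampingOp ha (u t).grad] with x hx hx'
    rw [hx, hx', real_inner_smul_left]
    ring
  have e4 : ∫ x in Ω, (u t).fn x ^ 5 * (θ t * φ x) =
      θ t * ∫ x in Ω, (u t).fn x ^ 5 * q.fn x := by
    rw [← integral_const_mul]
    refine integral_congr_ae ?_
    filter_upwards [h1] with x hx
    rw [hx]
    ring
  rw [e1, e2, e3, e4]
  ring

theorem InEnergySpace.continuousOn_timeDeriv {u : ℝ → H10 Ω} (hT : 0 < T)
    (hu : InEnergySpace T u) : ContinuousOn (timeDeriv T u) (Icc 0 T) :=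
  hu.2.continuousOn_derivWithin (uniqueDiffOn_Icc hT) le_rfl

theorem InEnergySpace.hasDerivWithinAt {u : ℝ → H10 Ω} (hu : InEnergySpace T u) {t : ℝ}
    (ht : t ∈ Icc 0 T) :
    HasDerivWithinAt (fun s => (u s).fn) (timeDeriv T u t) (Icc 0 T) t :=
  (hu.2.differentiableOn one_ne_zero t ht).hasDerivWithinAt

/-- The equation integrated in time, tested with an arbitrary element of `H_0^1(Ω)`. -/
theorem SolvesWeakly.integrated {a : E3 → ℝ} (ha : MemLp a ⊤ (volume.restrict Ω))
    (hT : 0 < T) {u : ℝ → H10 Ω} (hE : InEnergySpace T u) (hu : SolvesWeakly a T u)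
    {s t : ℝ} (hs : s ∈ Icc 0 T) (ht : t ∈ Icc 0 T) (q : H10 Ω) :
    momentum ha (timeDeriv T u t) (u t) q - momentum ha (timeDeriv T u s) (u s) q
      + ∫ r in s..t, (u r).force q = 0 := by
  obtain ⟨M, hM⟩ := isCompact_Icc.exists_bound_of_continuousOn hE.1
  have hM0 : 0 ≤ M := (norm_nonneg _).trans (hM s hs)
  refine integrated_of_weak hT (S := (testGraph Ω).topologicalClosure.subtype ⁻¹' testGraph Ω)
    (G := fun t => momentum ha (timeDeriv T u t) (u t)) (F := fun t => (u t).force)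
    (M := M + 5 * (sobolevConst * M) ^ 5 * sobolevConst) ?_ ?_ ?_ ?_ ?_ ?_ hs ht q
  -- The graph of the test functions is dense in its own closure, which is H_0^1(Ω) by definition.
  · intro p
    refine closure_subtype.2 (closure_mono ?_ p.2)
    exact fun x hx => ⟨⟨x, (testGraph Ω).le_topologicalClosure hx⟩, hx, rfl⟩
  · intro q
    exact ((hE.continuousOn_timeDeriv hT).inner continuousOn_const).add
      ((((dampingOp ha).continuous.comp H10.continuous_grad).comp_continuousOn hE.1).inner
        continuousOn_const)
  · intro t
    exact (continuous_const.inner H10.continuous_fn).add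
      (continuous_const.inner H10.continuous_grad)
  · exact fun q => (H10.continuous_force q).comp_continuousOn hE.1
  · intro t ht q q'
    refine ((u t).abs_force_sub_le q q').trans ?_
    have := hM t ht
    gcongr
  · exact fun q hq θ hθ => hu.integral_test ha hq hθ

end Weak

/-! ### The equation for the difference of two solutions. -/

section Difference

variable {Ω : Set E3} {T : ℝ}

/-- The L¹² bounds absorb the quartic factor, so q enters only through its L² norm. This matters
because in the limit q plays the role of w_t. -/
theorem abs_quintic_sub_le_of_ae_eq {p p' : H10 Ω} {U U' : Lp ℝ 12 (volume.restrict Ω)}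
    (hU : U =ᵐ[volume.restrict Ω] p.fn) (hU' : U' =ᵐ[volume.restrict Ω] p'.fn) (q : H10 Ω) :
    |p.quintic q - p'.quintic q| ≤
      5 * sobolevConst * (‖U‖ ^ 4 + ‖U'‖ ^ 4) * ‖(p - p').grad‖ * ‖q.fn‖ := by
  have hp : MemLp p.fn 12 (volume.restrict Ω) := (Lp.memLp U).ae_eq hU
  have hp' : MemLp p'.fn 12 (volume.restrict Ω) := (Lp.memLp U').ae_eq hU'
  have h := abs_integral_quintic_sub_mul_le (P := 12) (Q := 2) (by norm_num) (by norm_num)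
    (by norm_num) (by norm_num) (by norm_num) hp hp' (p.memLp_six_sub p') (Lp.memLp q.fn)
  rw [H10.quintic_sub_apply]
  refine h.trans ?_
  rw [← eLpNorm_congr_ae hU, ← eLpNorm_congr_ae hU', ← Lp.norm_def, ← Lp.norm_def, ← Lp.norm_def]
  have h6 := p.toReal_eLpNorm_six_sub_le p'
  have h2 := mul_le_mul_of_nonneg_right (mul_le_mul_of_nonneg_left h6
    (by positivity : 0 ≤ ‖U‖ ^ 4 + ‖U'‖ ^ 4)) (norm_nonneg q.fn)
  linarith

/-- The coefficient controlling the difference of the nonlinearities of two solutions. -/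
def strichartzCoeff (T : ℝ) (U U' : ℝ → Lp ℝ 12 (volume.restrict Ω)) : ℝ → ℝ :=
  (Ioo 0 T).indicator fun t => 5 * sobolevConst * (‖U t‖ ^ 4 + ‖U' t‖ ^ 4)

theorem strichartzCoeff_nonneg (U U' : ℝ → Lp ℝ 12 (volume.restrict Ω)) (t : ℝ) :
    0 ≤ strichartzCoeff T U U' t :=
  indicator_nonneg (fun _ _ => by positivity) t

theorem integrable_strichartzCoeff {U U' : ℝ → Lp ℝ 12 (volume.restrict Ω)}
    (hU : MemLp U 4 (volume.restrict (Ioo 0 T))) (hU' : MemLp U' 4 (volume.restrict (Ioo 0 T))) :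
    Integrable (strichartzCoeff T U U') := by
  rw [strichartzCoeff, integrable_indicator_iff measurableSet_Ioo]
  exact ((MemLp.integrable_norm_pow (p := 4) hU (by norm_num)).add
    (MemLp.integrable_norm_pow (p := 4) hU' (by norm_num))).const_mul _

/-- The difference of two energy solutions in the Strichartz class, extended to be constant
outside `[0,T]`, solves a damped equation whose forcing is controlled by its energy. -/
theorem dampedEquation_sub {a : E3 → ℝ} (ha : MemLp a ⊤ (volume.restrict Ω))
    (ha0 : ∀ᵐ x ∂(volume.restrict Ω), 0 ≤ a x) (hT : 0 < T) {u v : ℝ → H10 Ω}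
    (hu : InEnergySpace T u) (hv : InEnergySpace T v)
    (hu' : SolvesWeakly a T u) (hv' : SolvesWeakly a T v)
    {U U' : ℝ → Lp ℝ 12 (volume.restrict Ω)}
    (hU : MemLp U 4 (volume.restrict (Ioo 0 T))) (hU' : MemLp U' 4 (volume.restrict (Ioo 0 T)))
    (hUu : ∀ᵐ t ∂(volume.restrict (Ioo 0 T)), U t =ᵐ[volume.restrict Ω] (u t).fn)
    (hUv : ∀ᵐ t ∂(volume.restrict (Ioo 0 T)), U' t =ᵐ[volume.restrict Ω] (v t).fn)
    {w : ℝ → H10 Ω} (hw : Continuous w) (hwuv : ∀ t ∈ Icc 0 T, w t = u t - v t) :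
    DampedEquation (H10.fnL Ω) (H10.gradL Ω)
      (fun p q => inner ℝ (dampingOp ha p.grad) q.grad) w
      (fun t => timeDeriv T u t - timeDeriv T v t)
      (fun r q => (u r).quintic q - (v r).quintic q)
      (fun r => strichartzCoeff T U U' r * ‖H10.gradL Ω (w r)‖) 0 T where
  continuous := hw
  deriv t ht := by
    refine ((hu.hasDerivWithinAt ht).sub (hv.hasDerivWithinAt ht)).congr (fun s hs => ?_) ?_
    · rw [hwuv s hs]
      rfl
    · rw [hwuv t ht]
      rfl
  nonneg p := inner_dampingOp_self_nonneg ha ha0 p.grad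
  integrable a b := (integrable_strichartzCoeff hU hU').intervalIntegrable.mul_continuousOn
    ((H10.gradL Ω).continuous.comp hw).norm.continuousOn
  forcing_nonneg r := mul_nonneg (strichartzCoeff_nonneg U U' r) (norm_nonneg _)
  forcing_le := by
    rw [← ae_restrict_iff' measurableSet_Icc, ← Measure.restrict_congr_set Ioo_ae_eq_Icc]
    filter_upwards [hUu, hUv, ae_restrict_mem measurableSet_Ioo] with r h1 h2 hr q
    rw [strichartzCoeff, indicator_of_mem hr, hwuv r (Ioo_subset_Icc_self hr)]
    exact abs_quintic_sub_le_of_ae_eq h1 h2 q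
  forcing_integrable q s hs t ht := by
    -- For a fixed q the pairing is continuous in time by the L⁶ bounds; the L¹² information is not
    -- involved.
    refine ContinuousOn.intervalIntegrable (ContinuousOn.mono ?_ (uIcc_subset_Icc hs ht))
    exact ((H10.continuous_quintic q).comp_continuousOn hu.1).sub
      ((H10.continuous_quintic q).comp_continuousOn hv.1)
  equation s hs t ht q := by
    have e1 := hu'.integrated ha hT hu hs ht q
    have e2 := hv'.integrated ha hT hv hs ht q
    have hi : ∀ {u : ℝ → H10 Ω}, InEnergySpace T u →
        IntervalIntegrable (fun r => (u r).force q) volume s t := fun h =>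
      (((H10.continuous_force q).comp_continuousOn h.1).mono
        (uIcc_subset_Icc hs ht)).intervalIntegrable
    have e3 : ∫ r in s..t, ((inner ℝ (H10.gradL Ω (w r)) (H10.gradL Ω q) : ℝ)
        + ((u r).quintic q - (v r).quintic q)) =
        (∫ r in s..t, (u r).force q) - ∫ r in s..t, (v r).force q := by
      rw [← intervalIntegral.integral_sub (hi hu) (hi hv)]
      refine intervalIntegral.integral_congr fun r hr => ?_
      simp only [hwuv r (uIcc_subset_Icc hs ht hr), H10.gradL_apply, H10.grad_sub,
        inner_sub_left, H10.force]
      ring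
    rw [e3, hwuv s hs, hwuv t ht]
    simp only [momentum] at e1 e2
    simp only [H10.grad_sub, map_sub, inner_sub_left, H10.fnL_apply]
    linarith

end Difference

end

theorem mainTheorem4 (Ω : Set E3) (hΩ : IsOpen Ω) (hΩb : Bornology.IsBounded Ω)
    (a : E3 → ℝ) (ha : MemW1Infty Ω a) (ha0 : ∀ᵐ x ∂(volume.restrict Ω), 0 ≤ a x)
    (T : ℝ) (hT : 0 < T) (u₀ : H10 Ω) (u₁ : L2 Ω) (u v : ℝ → H10 Ω)
    (hu : IsEnergySolution a T u₀ u₁ u) (hv : IsEnergySolution a T u₀ u₁ v)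
    (huS : InStrichartzClass T u) (hvS : InStrichartzClass T v) :
    ∀ t ∈ Icc 0 T, u t = v t := by
  obtain ⟨U, hU, hUu⟩ := huS
  obtain ⟨U', hU', hUv⟩ := hvS
  have hcont : ContinuousOn (fun t => u t - v t) (Icc 0 T) :=
    hu.energy_space.1.sub hv.energy_space.1
  have hwuv : ∀ t ∈ Icc 0 T,
      IccExtend hT.le ((Icc 0 T).domRestrict fun t => u t - v t) t = u t - v t := fun t ht => by
    rw [IccExtend_of_mem _ _ ht, domRestrict_apply]
  have H := dampedEquation_sub ha.1 ha0 hT hu.energy_space hv.energy_space hu.equation hv.equation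
    hU hU' hUu hUv hcont.domRestrict.Icc_extend' hwuv
  intro t ht
  have h0 : (0 : ℝ) ∈ Icc 0 T := ⟨le_rfl, hT.le⟩
  have hzero := H.eq_zero (strichartzCoeff_nonneg U U')
    (fun a b => (integrable_strichartzCoeff hU hU').intervalIntegrable)
    ((hu.energy_space.continuousOn_timeDeriv hT).sub (hv.energy_space.continuousOn_timeDeriv hT))
    (by rw [hu.init_deriv, hv.init_deriv, sub_self])
    (by rw [hwuv 0 h0, hu.init, hv.init, sub_self, map_zero]) ht
  have hgrad := hzero.2
  rw [hwuv t ht] at hgrad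
  -- The energy controls only ∇w; the Sobolev inequality turns ∇w = 0 into w = 0.
  exact sub_eq_zero.1 (H10.eq_zero_of_grad_eq_zero hgrad)
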